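/- Let $\alpha,\sigma:[0,1]\to[0,\infty)$ be a flow path, i.e. $\alpha_0=\sigma_1=1$, $\alpha_1=\sigma_0=0$, and let $t\in[0,1]$ be a time with $\sigma_t>0$ at which $\alpha,\sigma$ are differentiable (one-sidedly at an endpoint), with derivatives $\dot\alpha_t,\dot\sigma_t$. For a probability measure $p_0$ on $\mathbb R^d$ (the data distribution) let $x_0\sim p_0$ and $\varepsilon\sim\mathcal N(0,I)$ be independent and $x_t=\alpha_t x_0+\sigma_t\varepsilon$. Put $$p_t(x\mid x_0)=\mathcal N(x;\alpha_t x_0,\sigma_t^2I),\qquad Z_x(q)=\int p_t(x\mid x_0)\,q(dx_0),\qquad v_t(x\mid x_0)=\dot\alpha_t x_0+\frac{\dot\sigma_t}{\sigma_t}(x-\alpha_t x_0).$$ The marginal velocity for the data distribution $p_0$ is $$v_t(x)=\int v_t(x\mid x_0)\,\frac{p_t(x\mid x_0)}{Z_x(p_0)}\,p_0(dx_0),$$ and $\operatorname{Var}_x=\int\|v_t(x\mid x_0)-v_t(x)\|^2\frac{p_t(x\mid x_0)}{Z_x(p_0)}\,p_0(dx_0)$ is the variance of the conditional velocity given $x_t=x$.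 For points $y_1,\dots,y_N\in\mathbb R^d$ with $N\ge 1$, $p_{\rm emp}=\frac1N\sum_i\delta_{y_i}$ is their empirical measure, and the ideal (plug-in) velocity $v^*_t(x)=v^*_t(x\mid y_1,\dots,y_N)$ is the marginal velocity for the data distribution $p_{\rm emp}$. (1) If $p_0$ has a finite first moment, then $v_t(x_t)=\dot\alpha_t\,\mathbb E[x_0\mid x_t]+\dot\sigma_t\,\mathbb E[\varepsilon\mid x_t]$ almost surely. (2) For all $N\ge1$, $y_1,\dots,y_N$ and $x$, $$v^*_t(x\mid y_1,\dots,y_N)=\sum_{i=1}^N\frac{\mathcal N(x;\alpha_t y_i,\sigma_t^2I)}{\sum_{j=1}^N\mathcal N(x;\alpha_t y_j,\sigma_t^2I)}\Big(\dot\alpha_t y_i+\frac{\dot\sigma_t}{\sigma_t}(x-\alpha_t y_i)\Big).$$ (3) Let $s>d/2$ and $z_0>0$. There is a constant $C>0$, depending only on $d$, the flow path, $t$, $s$ and $z_0$, such that the following holds for every probability measure $p_0$ on $\mathbb R^d$, every $N\ge1$, all $M_1,M_2>0$, every open $\Omega\subseteq\mathbb R^d$ with $p_0(\Omega)=1$ and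 every Borel set $A\subseteq\mathbb R^d$. Let $y_1,\dots,y_N$ be i.i.d. with law $p_0$, independent of $(x_0,\varepsilon)$, and let $\mathbb E_y$ be the expectation over them. Suppose that for every $x\in A$: $Z_x(p_0)\ge z_0$; almost surely $Z_x(p_{\rm emp})\ge z_0$; $\|v_t(x\mid\cdot)\|_{C^s(\Omega)}\le M_1$; and $\|v_t(x)\|\le M_2$. Then for every $x\in A$, $\mathbb E_y\|v_t^*(x)\|^2<\infty$ and $$\mathbb E_y\|v^*_t(x)-v_t(x)\|^2\le C\Big(\frac{M_1^2+2M_2^2}{N}+\frac{4\operatorname{Var}_x}{N}\Big),$$ the squared bias satisfies $\|\mathbb E_y v^*_t(x)-v_t(x)\|^2\le C M_1^2/N$, and the variance of the velocity drops by at least the factor $1-C/N$: $$\operatorname{Var}_x-\mathbb E_y\|v^*_t(x)-\mathbb E_yv^*_t(x)\|^2\ \ge\ \Big(1-\frac CN\Big)\operatorname{Var}_x.$$ Moreover, on average over $x_t=\alpha_tx_0+\sigma_t\varepsilon$ in the region $A$, the following left-hand side is finite and $$\mathbb E\big[\|v^*_t(x_t)-v_t(x_t)\|^2;\,x_t\in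 A\big]\le C\Big(\frac{M_1^2+2M_2^2}{N}+\frac{4\,\mathbb E\big[\|v_t(x_t\mid x_0)-v_t(x_t)\|^2;\,x_t\in A\big]}{N}\Big).$$ Here $\|f\|_{C^s(\Omega)}$ is the usual Hölder norm: with $k=\lfloor s\rfloor$, the largest of the suprema over $\Omega$ of the norms of the derivatives of order at most $k$ and, if $s\notin\mathbb N$, of the $(s-k)$-Hölder seminorm of the $k$-th derivative. -/

import Mathlib

open MeasureTheory ProbabilityTheory Set
open scoped ENNReal

noncomputable section

/-- Data and noise live in `ℝ^d` with the Euclidean norm. -/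
abbrev Eu (d : ℕ) : Type := EuclideanSpace ℝ (Fin d)

/-- A flow path: the interpolation coefficients of `x_t = α_t x_0 + σ_t ε` on `[0,1]`. -/
structure FlowPath where
  α : ℝ → ℝ
  σ : ℝ → ℝ
  α_nonneg : ∀ t ∈ Icc (0 : ℝ) 1, 0 ≤ α t
  σ_nonneg : ∀ t ∈ Icc (0 : ℝ) 1, 0 ≤ σ t
  α_zero : α 0 = 1
  α_one : α 1 = 0
  σ_zero : σ 0 = 0
  σ_one : σ 1 = 1

namespace FlowPath

/-- The time derivative of `α` (one-sided at the endpoints of `[0,1]`). -/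
def dα (P : FlowPath) (t : ℝ) : ℝ := derivWithin P.α (Icc 0 1) t

/-- The time derivative of `σ` (one-sided at the endpoints of `[0,1]`). -/
def dσ (P : FlowPath) (t : ℝ) : ℝ := derivWithin P.σ (Icc 0 1) t

/-- The interpolant `x_t = α_t x_0 + σ_t ε` as a function of `ω = (x_0, ε)`. -/
def interp {d : ℕ} (P : FlowPath) (t : ℝ) (ω : Eu d × Eu d) : Eu d :=
  P.α t • ω.1 + P.σ t • ω.2

end FlowPath

/-- The density `𝒩(x; m, σ² I)` of the isotropic Gaussian on `ℝ^d`, for `σ > 0`. -/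
def gaussianDensity {d : ℕ} (x m : Eu d) (σ : ℝ) : ℝ :=
  (Real.sqrt (2 * Real.pi * σ ^ 2) ^ d)⁻¹ * Real.exp (-‖x - m‖ ^ 2 / (2 * σ ^ 2))

/-- The transition density `p_t(x | x_0) = 𝒩(x; α_t x_0, σ_t² I)`. -/
def transDensity {d : ℕ} (P : FlowPath) (t : ℝ) (x x₀ : Eu d) : ℝ :=
  gaussianDensity x (P.α t • x₀) (P.σ t)

/-- The normalization constant `Z(q) = ∫ p_t(x | x_0) q(dx_0)` at the point `x`. -/
def normConst {d : ℕ} (P : FlowPath) (t : ℝ) (q : Measure (Eu d)) (x : Eu d) : ℝ :=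
  ∫ x₀, transDensity P t x x₀ ∂q

/-- The conditional velocity
`v_t(x | x_0) = α̇_t x_0 + σ̇_t ε`, with the noise `ε = (x - α_t x_0) / σ_t`. -/
def condVelocity {d : ℕ} (P : FlowPath) (t : ℝ) (x x₀ : Eu d) : Eu d :=
  P.dα t • x₀ + (P.dσ t / P.σ t) • (x - P.α t • x₀)

/-- The marginal velocity `v_t(x) = ∫ v_t(x | x_0) (p_t(x | x_0) / p_t(x)) q(dx_0)` when the data
distribution is `q`. -/
def marginalVelocity {d : ℕ} (P : FlowPath) (t : ℝ) (q : Measure (Eu d)) (x : Eu d) : Eu d :=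
  ∫ x₀, (transDensity P t x x₀ / normConst P t q x) • condVelocity P t x x₀ ∂q

/-- The variance of the conditional velocity given `x_t = x`, that is
`E[‖v_t(x_t | x_0) - v_t(x_t)‖² | x_t = x]`, when the data distribution is `q`. -/
def condVelocityVar {d : ℕ} (P : FlowPath) (t : ℝ) (q : Measure (Eu d)) (x : Eu d) : ℝ :=
  ∫ x₀, (transDensity P t x x₀ / normConst P t q x) *
    ‖condVelocity P t x x₀ - marginalVelocity P t q x‖ ^ 2 ∂q

/-- The empirical measure `(1/N) ∑ᵢ δ_{yᵢ}` of the points `y₁, …, y_N`. -/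
def empiricalMeasure {d N : ℕ} (y : Fin N → Eu d) : Measure (Eu d) :=
  (N : ℝ≥0∞)⁻¹ • ∑ i, Measure.dirac (y i)

/-- The ideal (plug-in) velocity `v*_t(x | y₁, …, y_N)`: the marginal velocity when the data
distribution is the empirical measure of `y₁, …, y_N`. -/
def idealVelocity {d N : ℕ} (P : FlowPath) (t : ℝ) (y : Fin N → Eu d) (x : Eu d) : Eu d :=
  marginalVelocity P t (empiricalMeasure y) x

/-- `‖f‖_{C^s(Ω)} ≤ M` for a real order `s ≥ 0` on an open set `Ω`: with `k = ⌊s⌋`, the function is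
`C^k` on `Ω`, its derivatives of order at most `k` are bounded by `M` on `Ω`, and, if `s` is not an
integer, its `k`-th derivative is Hölder of exponent `s - k` on `Ω` with constant `M`. -/
def CsNormLE {E F : Type*} [NormedAddCommGroup E] [NormedSpace ℝ E] [NormedAddCommGroup F]
    [NormedSpace ℝ F] (s : ℝ) (Ω : Set E) (f : E → F) (M : ℝ) : Prop :=
  ContDiffOn ℝ (⌊s⌋₊ : ℕ) f Ω ∧
  (∀ k ≤ ⌊s⌋₊, ∀ x ∈ Ω, ‖iteratedFDeriv ℝ k f x‖ ≤ M) ∧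
  ((⌊s⌋₊ : ℝ) < s → ∀ x ∈ Ω, ∀ y ∈ Ω,
    ‖iteratedFDeriv ℝ ⌊s⌋₊ f x - iteratedFDeriv ℝ ⌊s⌋₊ f y‖ ≤ M * ‖x - y‖ ^ (s - ⌊s⌋₊))

end

/-! The plug-in velocity is a self-normalized importance sampling estimator of the posterior mean
`v_t(x)`. Its weights sum to one, so its error is `(N Z_x(p_emp))⁻¹ ∑ ξ(y_i)` with `ξ = p_t(x | ·)
(v_t(x | ·) - v_t(x))` (`idealVelocity_sub`), and `ξ` has mean zero under `p₀` because `v_t(x)` is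
the mean of `v_t(x | ·)` with weights proportional to `p_t(x | ·)`.

In the squared norm the random factor is at most `(N z₀)⁻²`, and the i.i.d. centered sum has second
moment `N E‖ξ‖²`. If `K` is the peak of the Gaussian density, then `p_t ≤ K` and `Z_x(p₀) ≤ K` give
`E‖ξ‖² ≤ K Z_x(p₀) Var_x ≤ K² Var_x`. Hence the mean square error is at most `(K / z₀)² Var_x / N`
(`integral_norm_idealVelocity_sub_sq_le`). Squared bias and variance add up to this error, so each
obeys the same bound, and `Var_x ≤ M₁²`.

The conditional expectation formula and the averaged estimate both rest on disintegration: `(x₀,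
x_t)` has density `p_t(x | x₀)` with respect to `p₀ ⊗ dx`, so averaging over `x_t ∈ B` can be done
over the posterior of `x₀` first (`setIntegral_posteriorAverage_interp`). -/

/-! ### The Gaussian density and the law of `m + σ ε` -/

lemma gaussianDensity_pos {d : ℕ} (x m : Eu d) {σ : ℝ} (hσ : 0 < σ) :
    0 < gaussianDensity x m σ := by
  unfold gaussianDensity
  positivity

lemma gaussianDensity_le {d : ℕ} (x m : Eu d) (σ : ℝ) :
    gaussianDensity x m σ ≤ (Real.sqrt (2 * Real.pi * σ ^ 2) ^ d)⁻¹ := by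
  unfold gaussianDensity
  refine mul_le_of_le_one_right (by positivity) (Real.exp_le_one_iff.2 ?_)
  rw [neg_div]
  exact neg_nonpos.2 (by positivity)

lemma transDensity_pos {d : ℕ} (P : FlowPath) {t : ℝ} (hσ : 0 < P.σ t) (x x₀ : Eu d) :
    0 < transDensity P t x x₀ := gaussianDensity_pos _ _ hσ

lemma transDensity_le {d : ℕ} (P : FlowPath) (t : ℝ) (x x₀ : Eu d) :
    transDensity P t x x₀ ≤ (Real.sqrt (2 * Real.pi * P.σ t ^ 2) ^ d)⁻¹ := gaussianDensity_le _ _ _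

lemma continuous_transDensity {d : ℕ} (P : FlowPath) (t : ℝ) :
    Continuous fun z : Eu d × Eu d => transDensity P t z.2 z.1 := by
  unfold transDensity gaussianDensity
  fun_prop

lemma continuous_condVelocity {d : ℕ} (P : FlowPath) (t : ℝ) :
    Continuous fun z : Eu d × Eu d => condVelocity P t z.2 z.1 := by
  unfold condVelocity
  fun_prop

lemma sqrt_pow_eq_rpow {a : ℝ} (ha : 0 ≤ a) (d : ℕ) : Real.sqrt a ^ d = a ^ ((d : ℝ) / 2) := by
  rw [Real.sqrt_eq_rpow, ← Real.rpow_natCast, ← Real.rpow_mul ha]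
  congr 1
  ring

lemma integrable_gaussianDensity {d : ℕ} (m : Eu d) {σ : ℝ} (hσ : 0 < σ) :
    Integrable fun x : Eu d => gaussianDensity x m σ := by
  have hb : 0 < (((2 * σ ^ 2)⁻¹ : ℝ) : ℂ).re := by
    rw [Complex.ofReal_re]; positivity
  have h := (GaussianFourier.integrable_cexp_neg_mul_sq_norm_add hb 0 (0 : Eu d)).norm
  have h2 : Integrable fun x : Eu d => gaussianDensity x 0 σ := by
    refine (h.const_mul (Real.sqrt (2 * Real.pi * σ ^ 2) ^ d)⁻¹).congr (.of_forall fun x => ?_)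
    simp only [gaussianDensity, Complex.norm_exp, sub_zero]
    congr 2
    simp [← Complex.ofReal_pow, ← Complex.ofReal_mul]
    ring
  simpa [gaussianDensity] using h2.comp_sub_right m

lemma charFun_withDensity_gaussianDensity {d : ℕ} (m u : Eu d) {σ : ℝ} (hσ : 0 < σ) :
    charFun (volume.withDensity fun x : Eu d => ENNReal.ofReal (gaussianDensity x m σ)) u =
      Complex.exp (inner ℝ m u * Complex.I) * Complex.exp (-‖σ • u‖ ^ 2 / 2) := by
  have hσ' : (σ : ℂ) ≠ 0 := by exact_mod_cast hσ.ne'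
  have hb : 0 < (((2 * σ ^ 2)⁻¹ : ℝ) : ℂ).re := by
    rw [Complex.ofReal_re]; positivity
  have hm : Measurable fun x : Eu d => ENNReal.ofReal (gaussianDensity x m σ) := by
    unfold gaussianDensity
    fun_prop
  rw [charFun_apply, integral_withDensity_eq_integral_toReal_smul hm (by simp),
    ← integral_add_left_eq_self _ m]
  have key := GaussianFourier.integral_cexp_neg_mul_sq_norm_add hb Complex.I u
  -- The prefactor of the density cancels the value `(2πσ²)^(d/2)` of the Gaussian integral.
  have hK : (((Real.sqrt (2 * Real.pi * σ ^ 2) ^ d)⁻¹ : ℝ) : ℂ) *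
      (Real.pi / (((2 * σ ^ 2)⁻¹ : ℝ) : ℂ)) ^ ((Module.finrank ℝ (Eu d) : ℂ) / 2) = 1 := by
    have h1 : (Real.pi / (((2 * σ ^ 2)⁻¹ : ℝ) : ℂ)) = ((2 * Real.pi * σ ^ 2 : ℝ) : ℂ) := by
      push_cast
      field_simp
    have h2 : ((Module.finrank ℝ (Eu d) : ℂ) / 2) = (((d : ℝ) / 2 : ℝ) : ℂ) := by simp
    rw [h1, h2, ← Complex.ofReal_cpow (by positivity), ← sqrt_pow_eq_rpow (by positivity),
      ← Complex.ofReal_mul, inv_mul_cancel₀ (by positivity), Complex.ofReal_one]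
  calc _ = ∫ z : Eu d, (((Real.sqrt (2 * Real.pi * σ ^ 2) ^ d)⁻¹ : ℝ) *
        Complex.exp (inner ℝ m u * Complex.I)) *
        Complex.exp (-(((2 * σ ^ 2)⁻¹ : ℝ) : ℂ) * ‖z‖ ^ 2 + Complex.I * inner ℝ u z) := by
        congr 1 with z
        rw [ENNReal.toReal_ofReal (gaussianDensity_pos _ _ hσ).le]
        simp only [gaussianDensity, add_sub_cancel_left, Complex.real_smul, inner_add_left,
          Complex.ofReal_mul, Complex.ofReal_exp, Complex.ofReal_add, add_mul, Complex.exp_add,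
          real_inner_comm z u]
        rw [mul_comm Complex.I]
        have : (((-‖z‖ ^ 2 / (2 * σ ^ 2) : ℝ)) : ℂ) = -(((2 * σ ^ 2)⁻¹ : ℝ) : ℂ) * ‖z‖ ^ 2 := by
          push_cast
          ring
        rw [this]
        ring
    _ = _ := by
        rw [integral_const_mul, key, mul_mul_mul_comm, hK, one_mul]
        congr 2
        rw [norm_smul, Real.norm_of_nonneg hσ.le, Complex.I_sq]
        push_cast
        field_simp
        norm_num

/-- Both sides are finite measures with the same characteristic function. This links the abstract
`stdGaussian` to the explicit density. -/
lemma map_add_smul_stdGaussian {d : ℕ} (m : Eu d) {σ : ℝ} (hσ : 0 < σ) :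
    (stdGaussian (Eu d)).map (fun ε => m + σ • ε) =
      volume.withDensity fun x => ENNReal.ofReal (gaussianDensity x m σ) := by
  have : IsFiniteMeasure
      (volume.withDensity fun x : Eu d => ENNReal.ofReal (gaussianDensity x m σ)) :=
    isFiniteMeasure_withDensity_ofReal (integrable_gaussianDensity m hσ).2
  have : IsProbabilityMeasure ((stdGaussian (Eu d)).map (fun ε => m + σ • ε)) :=
    Measure.isProbabilityMeasure_map (by fun_prop)
  apply Measure.ext_of_charFun
  ext u
  rw [charFun_withDensity_gaussianDensity m u hσ, charFun_apply,
    integral_map (by fun_prop) (by fun_prop), ← Complex.ofReal_pow, ← Complex.ofReal_neg]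
  have := charFun_stdGaussian (E := Eu d) (σ • u)
  rw [charFun_apply] at this
  push_cast at this ⊢
  rw [← this, ← integral_const_mul]
  congr 1 with z
  rw [← Complex.exp_add, inner_add_left, real_inner_smul_left, real_inner_smul_right]
  push_cast
  ring_nf

/-! ### The joint law of `(x₀, x_t)` and posterior averages -/

section law

variable {d : ℕ} (P : FlowPath) (t : ℝ) (p₀ : Measure (Eu d))

lemma measurable_interp : Measurable (P.interp t : Eu d × Eu d → Eu d) := by
  unfold FlowPath.interp
  fun_prop

/-- The joint law of `(x₀, x_t)`. -/
lemma map_fst_interp (hσ : 0 < P.σ t) :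
    (p₀.prod (stdGaussian (Eu d))).map (fun ω => (ω.1, P.interp t ω)) =
      (p₀.prod volume).withDensity fun z => ENNReal.ofReal (transDensity P t z.2 z.1) := by
  have hw : Measurable fun z : Eu d × Eu d => ENNReal.ofReal (transDensity P t z.2 z.1) :=
    (continuous_transDensity P t).measurable.ennreal_ofReal
  have hT : Measurable fun ω : Eu d × Eu d => (ω.1, P.interp t ω) :=
    measurable_fst.prodMk (measurable_interp P t)
  refine Measure.ext_of_lintegral _ fun f hf => ?_
  have hwf : Measurable fun z : Eu d × Eu d => ENNReal.ofReal (transDensity P t z.2 z.1) * f z :=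
    hw.mul hf
  rw [lintegral_map hf hT, lintegral_withDensity_eq_lintegral_mul _ hw hf]
  simp only [Pi.mul_apply]
  rw [lintegral_prod (fun ω => f (ω.1, P.interp t ω)) (hf.comp hT).aemeasurable,
    lintegral_prod _ hwf.aemeasurable]
  -- For fixed `x₀`, independence leaves `x_t` with the law of `α_t x₀ + σ_t ε`.
  refine lintegral_congr fun x₀ => ?_
  have h := map_add_smul_stdGaussian (P.α t • x₀) hσ
  have hf' : Measurable fun x => f (x₀, x) := by fun_prop
  have hw' : Measurable fun x => ENNReal.ofReal (transDensity P t x x₀) :=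
    ((continuous_transDensity P t).comp (Continuous.prodMk_right x₀)).measurable.ennreal_ofReal
  calc ∫⁻ ε, f (x₀, P.α t • x₀ + P.σ t • ε) ∂(stdGaussian (Eu d))
      = ∫⁻ x, f (x₀, x) ∂((stdGaussian (Eu d)).map (fun ε => P.α t • x₀ + P.σ t • ε)) :=
        (lintegral_map hf' (by fun_prop)).symm
    _ = ∫⁻ x, f (x₀, x) ∂(volume.withDensity fun x => ENNReal.ofReal (transDensity P t x x₀)) := by
        rw [h]
        rfl
    _ = ∫⁻ x, ENNReal.ofReal (transDensity P t x x₀) * f (x₀, x) :=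
        lintegral_withDensity_eq_lintegral_mul _ hw' hf'

variable {E : Type*} [NormedAddCommGroup E] [NormedSpace ℝ E]

lemma integrable_interp_iff (hσ : 0 < P.σ t) {F : Eu d × Eu d → E} (hF : StronglyMeasurable F) :
    Integrable (fun ω => F (ω.1, P.interp t ω)) (p₀.prod (stdGaussian (Eu d))) ↔
      Integrable (fun z => transDensity P t z.2 z.1 • F z) (p₀.prod volume) := by
  have hw : Measurable fun z : Eu d × Eu d => ENNReal.ofReal (transDensity P t z.2 z.1) :=
    (continuous_transDensity P t).measurable.ennreal_ofReal
  have hT : Measurable fun ω : Eu d × Eu d => (ω.1, P.interp t ω) :=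
    measurable_fst.prodMk (measurable_interp P t)
  rw [← Function.comp_def F, ← integrable_map_measure hF.aestronglyMeasurable hT.aemeasurable,
    map_fst_interp P t p₀ hσ, integrable_withDensity_iff_integrable_smul' hw (by simp)]
  refine integrable_congr (.of_forall fun z => ?_)
  simp only
  rw [ENNReal.toReal_ofReal (transDensity_pos P hσ _ _).le]

variable [IsProbabilityMeasure p₀]

lemma integral_interp (hσ : 0 < P.σ t) {F : Eu d × Eu d → E} (hF : StronglyMeasurable F)
    (hi : Integrable (fun ω => F (ω.1, P.interp t ω)) (p₀.prod (stdGaussian (Eu d)))) :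
    ∫ ω, F (ω.1, P.interp t ω) ∂(p₀.prod (stdGaussian (Eu d))) =
      ∫ x, ∫ x₀, transDensity P t x x₀ • F (x₀, x) ∂p₀ := by
  have hw : Measurable fun z : Eu d × Eu d => ENNReal.ofReal (transDensity P t z.2 z.1) :=
    (continuous_transDensity P t).measurable.ennreal_ofReal
  have hT : Measurable fun ω : Eu d × Eu d => (ω.1, P.interp t ω) :=
    measurable_fst.prodMk (measurable_interp P t)
  rw [← integral_prod_symm (f := fun z => transDensity P t z.2 z.1 • F z)
    ((integrable_interp_iff P t p₀ hσ hF).1 hi), ← integral_map hT.aemeasurable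
    hF.aestronglyMeasurable, map_fst_interp P t p₀ hσ,
    integral_withDensity_eq_integral_toReal_smul hw (by simp)]
  refine integral_congr_ae (.of_forall fun z => ?_)
  simp only
  rw [ENNReal.toReal_ofReal (transDensity_pos P hσ _ _).le]

lemma integrable_transDensity (q : Measure (Eu d)) [IsFiniteMeasure q] (hσ : 0 < P.σ t)
    (x : Eu d) : Integrable (fun x₀ => transDensity P t x x₀) q := by
  refine Integrable.of_bound ((continuous_transDensity P t).comp
    (Continuous.prodMk continuous_id continuous_const)).aestronglyMeasurable
    (Real.sqrt (2 * Real.pi * P.σ t ^ 2) ^ d)⁻¹ (.of_forall fun x₀ => ?_)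
  rw [Real.norm_of_nonneg (transDensity_pos P hσ _ _).le]
  exact transDensity_le _ _ _ _

lemma normConst_pos (hσ : 0 < P.σ t) (x : Eu d) : 0 < normConst P t p₀ x := by
  unfold normConst
  rw [integral_pos_iff_support_of_nonneg (fun x₀ => (transDensity_pos P hσ x x₀).le)
    (integrable_transDensity P t p₀ hσ x)]
  have : Function.support (fun x₀ => transDensity P t x x₀) = univ :=
    eq_univ_of_forall fun x₀ => (transDensity_pos P hσ x x₀).ne'
  simp [this]

lemma normConst_le (hσ : 0 < P.σ t) (x : Eu d) :
    normConst P t p₀ x ≤ (Real.sqrt (2 * Real.pi * P.σ t ^ 2) ^ d)⁻¹ := by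
  calc normConst P t p₀ x ≤ ∫ _, (Real.sqrt (2 * Real.pi * P.σ t ^ 2) ^ d)⁻¹ ∂p₀ :=
        integral_mono (integrable_transDensity P t p₀ hσ x) (integrable_const _)
          fun _ => transDensity_le _ _ _ _
    _ = _ := by simp

lemma stronglyMeasurable_normConst : StronglyMeasurable (normConst P t p₀) :=
  (continuous_transDensity P t).stronglyMeasurable.integral_prod_left'

/-- The posterior average of `F (·, x)` under the law of `x₀` given `x_t = x`. -/
noncomputable def posteriorAverage (F : Eu d × Eu d → E) (x : Eu d) : E :=
  ∫ x₀, (transDensity P t x x₀ / normConst P t p₀ x) • F (x₀, x) ∂p₀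

lemma stronglyMeasurable_posteriorAverage {F : Eu d × Eu d → E} (hF : StronglyMeasurable F) :
    StronglyMeasurable (posteriorAverage P t p₀ F) := by
  have h : StronglyMeasurable fun z : Eu d × Eu d =>
      (transDensity P t z.2 z.1 / normConst P t p₀ z.2) • F z :=
    ((continuous_transDensity P t).stronglyMeasurable.div
      ((stronglyMeasurable_normConst P t p₀).comp_measurable measurable_snd)).smul hF
  exact h.integral_prod_left'

/-- The normalization depends on `x` alone, so it can be cleared; later computations use this
unnormalized form. -/
lemma normConst_smul_posteriorAverage (hσ : 0 < P.σ t) (F : Eu d × Eu d → E) (x : Eu d) :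
    normConst P t p₀ x • posteriorAverage P t p₀ F x =
      ∫ x₀, transDensity P t x x₀ • F (x₀, x) ∂p₀ := by
  unfold posteriorAverage
  rw [← integral_smul]
  congr 1 with x₀
  rw [smul_smul, mul_div_cancel₀ _ (normConst_pos P t p₀ hσ x).ne']

/-- The average does not depend on `x₀`, so integrating its norm against `p_t(x | ·)` gives `Z_x`
times that norm, which is `‖∫ p_t(x | x₀) F(x₀, x) p₀(dx₀)‖`. Fubini makes this integrable in `x`.
-/
lemma integrable_posteriorAverage_interp [CompleteSpace E]
    (hσ : 0 < P.σ t) {F : Eu d × Eu d → E} (hF : StronglyMeasurable F)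
    (hi : Integrable (fun ω => F (ω.1, P.interp t ω)) (p₀.prod (stdGaussian (Eu d)))) :
    Integrable (fun ω => posteriorAverage P t p₀ F (P.interp t ω))
      (p₀.prod (stdGaussian (Eu d))) := by
  have hpm := stronglyMeasurable_posteriorAverage P t p₀ hF
  rw [integrable_interp_iff P t p₀ hσ
    (F := fun z => posteriorAverage P t p₀ F z.2) (hpm.comp_measurable measurable_snd)]
  have hi' := ((integrable_interp_iff P t p₀ hσ hF).1 hi).integral_prod_right
  have hm : StronglyMeasurable fun z : Eu d × Eu d =>
      transDensity P t z.2 z.1 • posteriorAverage P t p₀ F z.2 :=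
    (continuous_transDensity P t).stronglyMeasurable.smul (hpm.comp_measurable measurable_snd)
  rw [integrable_prod_iff' hm.aestronglyMeasurable]
  refine ⟨.of_forall fun x => (integrable_transDensity P t p₀ hσ x).smul_const
    (posteriorAverage P t p₀ F x), ?_⟩
  refine hi'.norm.congr (.of_forall fun x => ?_)
  simp only [norm_smul, Real.norm_of_nonneg (transDensity_pos P hσ _ _).le]
  rw [integral_mul_const, ← normConst_smul_posteriorAverage P t p₀ hσ F x, norm_smul,
    Real.norm_of_nonneg (normConst_pos P t p₀ hσ x).le]
  rfl

lemma integral_posteriorAverage_interp [CompleteSpace E]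
    (hσ : 0 < P.σ t) {F : Eu d × Eu d → E} (hF : StronglyMeasurable F)
    (hi : Integrable (fun ω => F (ω.1, P.interp t ω)) (p₀.prod (stdGaussian (Eu d)))) :
    ∫ ω, posteriorAverage P t p₀ F (P.interp t ω) ∂(p₀.prod (stdGaussian (Eu d))) =
      ∫ ω, F (ω.1, P.interp t ω) ∂(p₀.prod (stdGaussian (Eu d))) := by
  have hpm := stronglyMeasurable_posteriorAverage P t p₀ hF
  rw [integral_interp P t p₀ hσ hF hi, integral_interp P t p₀ hσ
    (F := fun z => posteriorAverage P t p₀ F z.2) (hpm.comp_measurable measurable_snd)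
    (integrable_posteriorAverage_interp P t p₀ hσ hF hi)]
  congr 1 with x
  dsimp only
  rw [integral_smul_const, ← normConst, normConst_smul_posteriorAverage P t p₀ hσ]

/-- Averaging over `x_t ∈ B` first over the posterior of `x₀` given `x_t`, then over `x_t`. -/
lemma setIntegral_posteriorAverage_interp [CompleteSpace E]
    (hσ : 0 < P.σ t) {F : Eu d × Eu d → E} (hF : StronglyMeasurable F)
    {B : Set (Eu d)} (hB : MeasurableSet B)
    (hi : IntegrableOn (fun ω => F (ω.1, P.interp t ω)) (P.interp t ⁻¹' B)
      (p₀.prod (stdGaussian (Eu d)))) :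
    IntegrableOn (fun ω => posteriorAverage P t p₀ F (P.interp t ω)) (P.interp t ⁻¹' B)
      (p₀.prod (stdGaussian (Eu d))) ∧
    ∫ ω in P.interp t ⁻¹' B, posteriorAverage P t p₀ F (P.interp t ω)
        ∂(p₀.prod (stdGaussian (Eu d))) =
      ∫ ω in P.interp t ⁻¹' B, F (ω.1, P.interp t ω) ∂(p₀.prod (stdGaussian (Eu d))) := by
  have hB' : MeasurableSet (P.interp t ⁻¹' B) := measurable_interp P t hB
  -- The indicator of `x ∈ B` does not involve `x₀`, so it passes through the posterior average and
  -- reduces the claim to the whole space.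
  let G : Eu d × Eu d → E := (Prod.snd ⁻¹' B).indicator F
  have hG : StronglyMeasurable G := hF.indicator (measurable_snd hB)
  have h1 : (fun ω => G (ω.1, P.interp t ω)) =
      (P.interp t ⁻¹' B).indicator fun ω => F (ω.1, P.interp t ω) := by
    ext ω
    by_cases h : P.interp t ω ∈ B <;> simp [G, indicator, h]
  have h2 : (fun ω => posteriorAverage P t p₀ G (P.interp t ω)) =
      (P.interp t ⁻¹' B).indicator fun ω => posteriorAverage P t p₀ F (P.interp t ω) := by
    ext ω
    by_cases h : P.interp t ω ∈ B <;> simp [G, indicator, h, posteriorAverage]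
  have hGi : Integrable (fun ω => G (ω.1, P.interp t ω)) (p₀.prod (stdGaussian (Eu d))) := by
    rw [h1]
    exact (integrable_indicator_iff hB').2 hi
  have h3 := integrable_posteriorAverage_interp P t p₀ hσ hG hGi
  have h4 := integral_posteriorAverage_interp P t p₀ hσ hG hGi
  rw [h2] at h3 h4
  rw [h1, integral_indicator hB', integral_indicator hB'] at h4
  exact ⟨(integrable_indicator_iff hB').1 h3, h4⟩

end law

/-! ### The plug-in velocity as a self-normalized weighted mean -/

section empirical

variable {d N : ℕ} (P : FlowPath) (t : ℝ)

lemma integral_empiricalMeasure {E : Type*} [NormedAddCommGroup E] [NormedSpace ℝ E]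
    [CompleteSpace E] (y : Fin N → Eu d) (f : Eu d → E) :
    ∫ x₀, f x₀ ∂(empiricalMeasure y) = (N : ℝ)⁻¹ • ∑ i, f (y i) := by
  unfold empiricalMeasure
  rw [integral_smul_measure, integral_finsetSum_measure fun i _ => integrable_dirac (by simp)]
  simp

lemma normConst_empiricalMeasure (y : Fin N → Eu d) (x : Eu d) :
    normConst P t (empiricalMeasure y) x = (N : ℝ)⁻¹ * ∑ i, transDensity P t x (y i) := by
  rw [normConst, integral_empiricalMeasure, smul_eq_mul]

lemma idealVelocity_eq_sum (hN : 0 < N) (y : Fin N → Eu d) (x : Eu d) :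
    idealVelocity P t y x = ∑ i, (transDensity P t x (y i) / ∑ j, transDensity P t x (y j)) •
      condVelocity P t x (y i) := by
  have hN' : (N : ℝ) ≠ 0 := by exact_mod_cast hN.ne'
  rw [idealVelocity, marginalVelocity, integral_empiricalMeasure, normConst_empiricalMeasure,
    Finset.smul_sum]
  refine Finset.sum_congr rfl fun i _ => ?_
  rw [smul_smul]
  congr 1
  rw [inv_mul_eq_div, div_div, mul_right_comm, inv_mul_cancel₀ hN', one_mul]

/-- The weights sum to one, so `v` moves inside the sum. The dependence between the summands is then
confined to one scalar factor, in front of a sum of functions of the single `y i`. -/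
lemma idealVelocity_sub (hσ : 0 < P.σ t) (hN : 0 < N) (y : Fin N → Eu d) (x v : Eu d) :
    idealVelocity P t y x - v = (N * normConst P t (empiricalMeasure y) x)⁻¹ •
      ∑ i, transDensity P t x (y i) • (condVelocity P t x (y i) - v) := by
  have hN' : (N : ℝ) ≠ 0 := by exact_mod_cast hN.ne'
  have : NeZero N := ⟨hN.ne'⟩
  have hS : 0 < ∑ j, transDensity P t x (y j) :=
    Finset.sum_pos (fun i _ => transDensity_pos P hσ _ _) Finset.univ_nonempty
  rw [idealVelocity_eq_sum P t hN, normConst_empiricalMeasure, mul_inv_cancel_left₀ hN']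
  simp only [smul_sub, Finset.sum_sub_distrib, ← Finset.sum_smul]
  rw [inv_smul_smul₀ hS.ne', Finset.smul_sum]
  simp only [smul_smul, div_eq_inv_mul]

lemma norm_idealVelocity_le (hσ : 0 < P.σ t) (hN : 0 < N) {y : Fin N → Eu d} {x : Eu d} {M : ℝ}
    (h : ∀ i, ‖condVelocity P t x (y i)‖ ≤ M) : ‖idealVelocity P t y x‖ ≤ M := by
  have : NeZero N := ⟨hN.ne'⟩
  have hS : 0 < ∑ j, transDensity P t x (y j) :=
    Finset.sum_pos (fun i _ => transDensity_pos P hσ _ _) Finset.univ_nonempty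
  rw [idealVelocity_eq_sum P t hN]
  calc _ ≤ ∑ i, (transDensity P t x (y i) / ∑ j, transDensity P t x (y j)) * M := by
        refine norm_sum_le_of_le _ fun i _ => ?_
        have := (div_pos (transDensity_pos P hσ x (y i)) hS).le
        rw [norm_smul, Real.norm_of_nonneg this]
        exact mul_le_mul_of_nonneg_left (h i) this
    _ = M := by rw [← Finset.sum_mul, ← Finset.sum_div, div_self hS.ne', one_mul]

lemma measurable_idealVelocity {X : Type*} [MeasurableSpace X] (hN : 0 < N) {f : X → Eu d}
    {y : X → Fin N → Eu d} (hf : Measurable f) (hy : Measurable y) :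
    Measurable fun z => idealVelocity P t (y z) (f z) := by
  have hw (i : Fin N) : Measurable fun z => transDensity P t (f z) (y z i) := by
    unfold transDensity gaussianDensity
    fun_prop
  have hg (i : Fin N) : Measurable fun z => condVelocity P t (f z) (y z i) := by
    unfold condVelocity
    fun_prop
  have hS : Measurable fun z => ∑ j, transDensity P t (f z) (y z j) :=
    Finset.measurable_fun_sum _ fun j _ => hw j
  simp only [idealVelocity_eq_sum P t hN]
  refine Finset.measurable_fun_sum _ fun i _ => ?_
  exact ((hw i).div hS).smul (hg i)

end empirical

/-! ### Second moments of i.i.d. sums; bias and variance -/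

section moments

variable {X : Type*} [MeasurableSpace X] (μ : Measure X)

lemma integral_norm_sq_eq_sum {d : ℕ} {f : X → Eu d} (hf : MemLp f 2 μ) :
    ∫ x, ‖f x‖ ^ 2 ∂μ = ∑ k, ∫ x, f x k ^ 2 ∂μ := by
  simp only [EuclideanSpace.real_norm_sq_eq]
  exact integral_finsetSum _ fun k _ => (hf.eval_piLp k).integrable_sq

variable [IsProbabilityMeasure μ]

lemma memLp_eval_pi {E : Type*} [NormedAddCommGroup E] {N : ℕ} {f : X → E} {p : ℝ≥0∞}
    (hf : MemLp f p μ) (i : Fin N) :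
    MemLp (fun y : Fin N → X => f (y i)) p (Measure.pi fun _ => μ) :=
  hf.comp_measurePreserving (measurePreserving_eval (fun _ : Fin N => μ) i)

/-- The second moment of a sum of i.i.d. centered random vectors. -/
lemma integral_norm_sum_sq_pi {d : ℕ} {f : X → Eu d} (hf : MemLp f 2 μ) (h0 : ∫ x, f x ∂μ = 0)
    (N : ℕ) :
    ∫ y, ‖∑ i : Fin N, f (y i)‖ ^ 2 ∂(Measure.pi fun _ => μ) = N * ∫ x, ‖f x‖ ^ 2 ∂μ := by
  have hsum : MemLp (fun y : Fin N → X => ∑ i, f (y i)) 2 (Measure.pi fun _ => μ) :=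
    memLp_finsetSum _ fun i _ => memLp_eval_pi μ hf i
  -- Work coordinate by coordinate, where real variances of independent terms add up.
  rw [integral_norm_sq_eq_sum _ hsum, integral_norm_sq_eq_sum _ hf, Finset.mul_sum]
  refine Finset.sum_congr rfl fun k _ => ?_
  have hk : MemLp (fun x => f x k) 2 μ := hf.eval_piLp k
  have hk0 : ∫ x, f x k ∂μ = 0 := by
    rw [← eval_integral_piLp fun k => (hf.eval_piLp k).integrable (by norm_num), h0]
    rfl
  have hv := variance_sum_pi (μ := fun _ : Fin N => μ) (X := fun _ x => f x k) fun _ => hk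
  have hS : (∑ i : Fin N, fun y : Fin N → X => f (y i) k) = fun y => ∑ i, f (y i) k := by
    ext y
    simp
  have hm : ∫ y, ∑ i : Fin N, f (y i) k ∂(Measure.pi fun _ => μ) = 0 := by
    rw [integral_finsetSum _ fun i _ => (memLp_eval_pi μ hk i).integrable (by norm_num)]
    refine Finset.sum_eq_zero fun i _ => ?_
    rw [integral_comp_eval (μ := fun _ : Fin N => μ) (f := fun x => f x k)
      hk.aestronglyMeasurable, hk0]
  rw [hS, variance_of_integral_eq_zero ?_ hm, Finset.sum_const, Finset.card_univ, Fintype.card_fin,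
    nsmul_eq_mul, variance_of_integral_eq_zero hk.aestronglyMeasurable.aemeasurable hk0] at hv
  · simpa using hv
  · exact Finset.aemeasurable_fun_sum _ fun i _ =>
      (memLp_eval_pi μ hk i).aestronglyMeasurable.aemeasurable

/-- The decomposition of the mean square deviation from `c` into variance and squared bias. -/
lemma integral_norm_sub_sq {d : ℕ} {f : X → Eu d} (hf : MemLp f 2 μ) (c : Eu d) :
    ∫ x, ‖f x - c‖ ^ 2 ∂μ =
      ∫ x, ‖f x - ∫ x', f x' ∂μ‖ ^ 2 ∂μ + ‖(∫ x, f x ∂μ) - c‖ ^ 2 := by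
  have hi : Integrable f μ := hf.integrable (by norm_num)
  set m := ∫ x, f x ∂μ with hm
  have h1 : MemLp (fun x => f x - m) 2 μ := hf.sub (memLp_const m)
  have h1i : Integrable (fun x => f x - m) μ := hi.sub (integrable_const m)
  have h2 : Integrable (fun x => ‖f x - m‖ ^ 2) μ := h1.integrable_norm_pow (by norm_num)
  have h3 : Integrable (fun x => 2 * inner ℝ (f x - m) (m - c)) μ :=
    (h1i.inner_const (m - c)).const_mul 2
  have h4 : ∫ x, 2 * inner ℝ (f x - m) (m - c) ∂μ = 0 := by
    rw [integral_const_mul]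
    have : ∫ x, inner ℝ (f x - m) (m - c) ∂μ = 0 := by
      simp only [real_inner_comm (m - c)]
      rw [integral_inner h1i, integral_sub hi (integrable_const m)]
      simp [← hm]
    rw [this, mul_zero]
  calc ∫ x, ‖f x - c‖ ^ 2 ∂μ
      = ∫ x, (‖f x - m‖ ^ 2 + 2 * inner ℝ (f x - m) (m - c) + ‖m - c‖ ^ 2) ∂μ := by
        congr 1 with x
        rw [← norm_add_sq_real, sub_add_sub_cancel]
    _ = _ := by
        have h5 : ∫ x, (‖f x - m‖ ^ 2 + 2 * inner ℝ (f x - m) (m - c)) ∂μ = ∫ x, ‖f x - m‖ ^ 2 ∂μ := by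
          rw [integral_add h2 h3, h4, add_zero]
        have h6 := integral_add (h2.add h3) (integrable_const (μ := μ) (‖m - c‖ ^ 2))
        simp only [Pi.add_apply] at h6
        rw [h6, h5]
        simp

end moments

/-! ### Error estimates at a fixed point `x` -/

section pointwise

variable {d : ℕ} (P : FlowPath) (t : ℝ) (p₀ : Measure (Eu d)) [IsProbabilityMeasure p₀]

lemma stronglyMeasurable_transDensity_left (x : Eu d) :
    StronglyMeasurable fun x₀ => transDensity P t x x₀ :=
  ((continuous_transDensity P t).comp
    (continuous_id.prodMk continuous_const)).stronglyMeasurable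

lemma stronglyMeasurable_condVelocity_left (x : Eu d) :
    StronglyMeasurable fun x₀ => condVelocity P t x x₀ :=
  ((continuous_condVelocity P t).comp
    (continuous_id.prodMk continuous_const)).stronglyMeasurable

variable {P t p₀} {x : Eu d} {M : ℝ}

lemma integrable_transDensity_smul {E : Type*} [NormedAddCommGroup E] [NormedSpace ℝ E]
    (hσ : 0 < P.σ t) {f : Eu d → E} (hf : StronglyMeasurable f) {M : ℝ}
    (hM : ∀ᵐ x₀ ∂p₀, ‖f x₀‖ ≤ M) :
    Integrable (fun x₀ => transDensity P t x x₀ • f x₀) p₀ :=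
  (integrable_transDensity P t p₀ hσ x).smul_bdd M hf.aestronglyMeasurable hM

/-- The centering that turns the error into a sum of mean-zero terms: `∫ p_t(x | x₀) v_t(x | x₀)
p₀(dx₀) = Z_x v_t(x)`. -/
lemma integral_transDensity_smul_sub (hσ : 0 < P.σ t)
    (hM : ∀ᵐ x₀ ∂p₀, ‖condVelocity P t x x₀‖ ≤ M) :
    ∫ x₀, transDensity P t x x₀ • (condVelocity P t x x₀ - marginalVelocity P t p₀ x) ∂p₀ = 0 := by
  simp only [smul_sub]
  rw [integral_sub
    (integrable_transDensity_smul hσ (stronglyMeasurable_condVelocity_left P t x) hM)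
    ((integrable_transDensity P t p₀ hσ x).smul_const _), integral_smul_const, ← normConst,
    sub_eq_zero]
  exact (normConst_smul_posteriorAverage P t p₀ hσ (fun z => condVelocity P t z.2 z.1) x).symm

lemma condVelocityVar_nonneg (hσ : 0 < P.σ t) : 0 ≤ condVelocityVar P t p₀ x :=
  integral_nonneg fun x₀ => mul_nonneg
    (div_nonneg (transDensity_pos P hσ x x₀).le (normConst_pos P t p₀ hσ x).le) (sq_nonneg _)

lemma normConst_mul_condVelocityVar (hσ : 0 < P.σ t) :
    normConst P t p₀ x * condVelocityVar P t p₀ x = ∫ x₀, transDensity P t x x₀ *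
      ‖condVelocity P t x x₀ - marginalVelocity P t p₀ x‖ ^ 2 ∂p₀ :=
  normConst_smul_posteriorAverage P t p₀ hσ
    (fun z => ‖condVelocity P t z.2 z.1 - marginalVelocity P t p₀ x‖ ^ 2) x

/-- A variance is at most the second moment: expand `‖g‖² = ‖(g - v) + v‖²`, drop `‖v‖²`, and note
that the cross term has weighted mean zero. -/
lemma condVelocityVar_le (hσ : 0 < P.σ t) (hM : ∀ᵐ x₀ ∂p₀, ‖condVelocity P t x x₀‖ ≤ M) :
    condVelocityVar P t p₀ x ≤ M ^ 2 := by
  have hZ := normConst_pos P t p₀ hσ x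
  refine le_of_mul_le_mul_left ?_ hZ
  rw [normConst_mul_condVelocityVar hσ]
  set v := marginalVelocity P t p₀ x with hv
  have hg := stronglyMeasurable_condVelocity_left P t x
  have hi : Integrable (fun x₀ => transDensity P t x x₀ •
      (condVelocity P t x x₀ - v)) p₀ :=
    integrable_transDensity_smul (M := M + ‖v‖) hσ (hg.sub stronglyMeasurable_const)
      (hM.mono fun x₀ h => (norm_sub_le _ _).trans (by gcongr))
  have hw := integrable_transDensity P t p₀ hσ x
  have hcross : ∫ x₀, inner ℝ v (transDensity P t x x₀ • (condVelocity P t x x₀ - v)) ∂p₀ = 0 := by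
    rw [integral_inner hi, integral_transDensity_smul_sub hσ hM, inner_zero_right]
  have hci : Integrable (fun x₀ =>
      inner ℝ v (transDensity P t x x₀ • (condVelocity P t x x₀ - v))) p₀ := hi.const_inner v
  calc ∫ x₀, transDensity P t x x₀ * ‖condVelocity P t x x₀ - v‖ ^ 2 ∂p₀
      ≤ ∫ x₀, (transDensity P t x x₀ * M ^ 2 -
          2 * inner ℝ v (transDensity P t x x₀ • (condVelocity P t x x₀ - v))) ∂p₀ := by
        refine integral_mono_of_nonneg (.of_forall fun x₀ => ?_)
          ((hw.mul_const _).sub (hci.const_mul 2)) (hM.mono fun x₀ h => ?_)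
        · exact mul_nonneg (transDensity_pos P hσ x x₀).le (sq_nonneg _)
        · have h1 : ‖condVelocity P t x x₀‖ ^ 2 ≤ M ^ 2 :=
            pow_le_pow_left₀ (norm_nonneg _) h 2
          have h2 := norm_add_sq_real (condVelocity P t x x₀ - v) v
          rw [sub_add_cancel] at h2
          have h3 : ‖condVelocity P t x x₀ - v‖ ^ 2 ≤
              M ^ 2 - 2 * inner ℝ v (condVelocity P t x x₀ - v) := by
            rw [real_inner_comm] at h2
            nlinarith [sq_nonneg ‖v‖]
          calc _ ≤ transDensity P t x x₀ *
                (M ^ 2 - 2 * inner ℝ v (condVelocity P t x x₀ - v)) :=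
                mul_le_mul_of_nonneg_left h3 (transDensity_pos P hσ x x₀).le
            _ = _ := by
                simp only [real_inner_smul_right]
                ring
    _ = normConst P t p₀ x * M ^ 2 := by
        rw [integral_sub (hw.mul_const _) (hci.const_mul 2), integral_const_mul, hcross,
          integral_mul_const, normConst]
        ring

variable {N : ℕ}

lemma memLp_idealVelocity (hσ : 0 < P.σ t) (hN : 0 < N)
    (hM : ∀ᵐ x₀ ∂p₀, ‖condVelocity P t x x₀‖ ≤ M) :
    MemLp (fun y => idealVelocity P t y x) 2 (Measure.pi fun _ : Fin N => p₀) := by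
  have hm : Measurable fun y : Fin N → Eu d => idealVelocity P t y x :=
    measurable_idealVelocity P t hN measurable_const measurable_id
  refine MemLp.of_bound hm.aestronglyMeasurable M ?_
  have : ∀ᵐ y ∂(Measure.pi fun _ : Fin N => p₀), ∀ i, ‖condVelocity P t x (y i)‖ ≤ M :=
    ae_all_iff.2 fun i =>
      (measurePreserving_eval (fun _ : Fin N => p₀) i).quasiMeasurePreserving.ae hM
  exact this.mono fun y hy => norm_idealVelocity_le P t hσ hN hy

lemma integrable_norm_idealVelocity_sub_sq (hσ : 0 < P.σ t) (hN : 0 < N)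
    (hM : ∀ᵐ x₀ ∂p₀, ‖condVelocity P t x x₀‖ ≤ M) (v : Eu d) :
    Integrable (fun y => ‖idealVelocity P t y x - v‖ ^ 2) (Measure.pi fun _ : Fin N => p₀) := by
  have h : MemLp (fun y => idealVelocity P t y x - v) 2 (Measure.pi fun _ : Fin N => p₀) :=
    (memLp_idealVelocity hσ hN hM).sub (memLp_const v)
  exact h.integrable_norm_pow (by norm_num)

/-- The mean square error of the plug-in velocity is at most the conditional variance over `N`,
up to a constant. -/
lemma integral_norm_idealVelocity_sub_sq_le (hσ : 0 < P.σ t) (hN : 0 < N) {z₀ : ℝ} (hz₀ : 0 < z₀)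
    (hM : ∀ᵐ x₀ ∂p₀, ‖condVelocity P t x x₀‖ ≤ M)
    (hz : ∀ᵐ y ∂(Measure.pi fun _ : Fin N => p₀), z₀ ≤ normConst P t (empiricalMeasure y) x) :
    ∫ y, ‖idealVelocity P t y x - marginalVelocity P t p₀ x‖ ^ 2
        ∂(Measure.pi fun _ : Fin N => p₀) ≤
      ((Real.sqrt (2 * Real.pi * P.σ t ^ 2) ^ d)⁻¹ / z₀) ^ 2 * (condVelocityVar P t p₀ x / N) := by
  set K := (Real.sqrt (2 * Real.pi * P.σ t ^ 2) ^ d)⁻¹ with hK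
  set v := marginalVelocity P t p₀ x with hv
  have hN' : (0 : ℝ) < N := by exact_mod_cast hN
  have hg := stronglyMeasurable_condVelocity_left P t x
  have hgv : ∀ᵐ x₀ ∂p₀, ‖condVelocity P t x x₀ - v‖ ≤ M + ‖v‖ :=
    hM.mono fun x₀ h => (norm_sub_le _ _).trans (by gcongr)
  let ξ : Eu d → Eu d := fun x₀ => transDensity P t x x₀ • (condVelocity P t x x₀ - v)
  have hw0 := fun x₀ => (transDensity_pos P hσ x x₀).le
  have hwK := fun x₀ => transDensity_le P t x x₀
  have hK0 : 0 ≤ K := by positivity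
  have hξ : MemLp ξ 2 p₀ := by
    refine MemLp.of_bound ((stronglyMeasurable_transDensity_left P t x).smul
      (hg.sub stronglyMeasurable_const)).aestronglyMeasurable (K * (M + ‖v‖))
      (hgv.mono fun x₀ h => ?_)
    rw [norm_smul, Real.norm_of_nonneg (hw0 x₀)]
    exact mul_le_mul (hwK x₀) h (norm_nonneg _) hK0
  have hsq : Integrable (fun x₀ => transDensity P t x x₀ * ‖condVelocity P t x x₀ - v‖ ^ 2) p₀ :=
    integrable_transDensity_smul (M := (M + ‖v‖) ^ 2) hσ
      ((hg.sub stronglyMeasurable_const).norm.pow 2) (hgv.mono fun x₀ h => by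
        rw [norm_pow, norm_norm]
        exact pow_le_pow_left₀ (norm_nonneg _) h 2)
  -- One factor `K` bounds one of the two powers of the density in `‖ξ‖²`; the other bounds
  -- `Z_x(p₀)`.
  have h1 : ∫ x₀, ‖ξ x₀‖ ^ 2 ∂p₀ ≤ K ^ 2 * condVelocityVar P t p₀ x := by
    calc ∫ x₀, ‖ξ x₀‖ ^ 2 ∂p₀
        ≤ ∫ x₀, K * (transDensity P t x x₀ * ‖condVelocity P t x x₀ - v‖ ^ 2) ∂p₀ := by
          refine integral_mono (hξ.integrable_norm_pow (by norm_num)) (hsq.const_mul K)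
            fun x₀ => ?_
          simp only [ξ]
          rw [norm_smul, Real.norm_of_nonneg (hw0 x₀), mul_pow, sq (transDensity P t x x₀),
            mul_assoc]
          exact mul_le_mul_of_nonneg_right (hwK x₀) (mul_nonneg (hw0 x₀) (sq_nonneg _))
      _ = K * (normConst P t p₀ x * condVelocityVar P t p₀ x) := by
          rw [integral_const_mul, normConst_mul_condVelocityVar hσ]
      _ ≤ K * (K * condVelocityVar P t p₀ x) :=
          mul_le_mul_of_nonneg_left (mul_le_mul_of_nonneg_right (normConst_le P t p₀ hσ x)
            (condVelocityVar_nonneg hσ)) hK0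
      _ = _ := by ring
  have h2 : MemLp (fun y : Fin N → Eu d => ∑ i, ξ (y i)) 2 (Measure.pi fun _ => p₀) :=
    memLp_finsetSum _ fun i _ => memLp_eval_pi p₀ hξ i
  -- The random normalization must become deterministic before the independence of the `y i` can be
  -- used.
  calc _ ≤ ∫ y : Fin N → Eu d, ((N * z₀)⁻¹) ^ 2 * ‖∑ i, ξ (y i)‖ ^ 2 ∂(Measure.pi fun _ => p₀) := by
        refine integral_mono_of_nonneg (.of_forall fun y => sq_nonneg _)
          ((h2.integrable_norm_pow (by norm_num)).const_mul _) (hz.mono fun y hy => ?_)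
        simp only
        rw [idealVelocity_sub P t hσ hN, norm_smul, mul_pow, Real.norm_of_nonneg
          (inv_nonneg.2 (mul_nonneg hN'.le (hz₀.le.trans hy)))]
        have hZ : 0 < N * normConst P t (empiricalMeasure y) x :=
          mul_pos hN' (hz₀.trans_le hy)
        have hle : (N * normConst P t (empiricalMeasure y) x)⁻¹ ≤ (N * z₀)⁻¹ := by gcongr
        exact mul_le_mul_of_nonneg_right (pow_le_pow_left₀ (inv_nonneg.2 hZ.le) hle 2)
          (sq_nonneg _)
    _ = ((N * z₀)⁻¹) ^ 2 * (N * ∫ x₀, ‖ξ x₀‖ ^ 2 ∂p₀) := by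
        rw [integral_const_mul, integral_norm_sum_sq_pi p₀ hξ
          (integral_transDensity_smul_sub hσ hM)]
    _ ≤ ((N * z₀)⁻¹) ^ 2 * (N * (K ^ 2 * condVelocityVar P t p₀ x)) := by gcongr
    _ = _ := by
        field_simp

end pointwise

/-! ### Conditional expectations and averages over `x_t` -/

section averaged

variable {d : ℕ} (P : FlowPath) (t : ℝ) (p₀ : Measure (Eu d)) [IsProbabilityMeasure p₀]

lemma stronglyMeasurable_marginalVelocity : StronglyMeasurable (marginalVelocity P t p₀) :=
  stronglyMeasurable_posteriorAverage P t p₀ (continuous_condVelocity P t).stronglyMeasurable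

variable {P t p₀}

lemma condVelocity_interp (hσ : 0 < P.σ t) (ω : Eu d × Eu d) :
    condVelocity P t (P.interp t ω) ω.1 = P.dα t • ω.1 + P.dσ t • ω.2 := by
  rw [condVelocity, FlowPath.interp, add_sub_cancel_left, smul_smul, div_mul_cancel₀ _ hσ.ne']

/-- Along the interpolant the conditional velocity is `α̇_t x₀ + σ̇_t ε`. Events of `σ(x_t)` are
preimages of Borel sets, so disintegration identifies `v_t(x_t)` as its conditional expectation, and
linearity splits it. -/
lemma marginalVelocity_interp_ae_eq (hσ : 0 < P.σ t) (hp : Integrable id p₀) :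
    (fun ω => marginalVelocity P t p₀ (P.interp t ω)) =ᵐ[p₀.prod (stdGaussian (Eu d))]
      fun ω => P.dα t • (p₀.prod (stdGaussian (Eu d)))[Prod.fst |
            MeasurableSpace.comap (P.interp t) inferInstance] ω +
        P.dσ t • (p₀.prod (stdGaussian (Eu d)))[Prod.snd |
            MeasurableSpace.comap (P.interp t) inferInstance] ω := by
  set μ := p₀.prod (stdGaussian (Eu d)) with hμ
  have hm := (measurable_interp (d := d) P t).comap_le
  have hfst : Integrable (Prod.fst : Eu d × Eu d → Eu d) μ := hp.comp_fst _
  have hsnd : Integrable (Prod.snd : Eu d × Eu d → Eu d) μ :=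
    (IsGaussian.integrable_id (μ := stdGaussian (Eu d))).comp_snd _
  have hF := (continuous_condVelocity (d := d) P t).stronglyMeasurable
  have hi : Integrable (fun ω : Eu d × Eu d => condVelocity P t (P.interp t ω) ω.1) μ := by
    simp only [condVelocity_interp hσ]
    exact (hfst.smul (P.dα t)).add (hsnd.smul (P.dσ t))
  have h1 : (fun ω => marginalVelocity P t p₀ (P.interp t ω)) =ᵐ[μ]
      μ[fun ω => condVelocity P t (P.interp t ω) ω.1 |
        MeasurableSpace.comap (P.interp t) inferInstance] := by
    refine ae_eq_condExp_of_forall_setIntegral_eq hm hi ?_ ?_ ?_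
    · rintro _ ⟨B, hB, rfl⟩ -
      exact (setIntegral_posteriorAverage_interp P t p₀ hσ hF hB hi.integrableOn).1
    · rintro _ ⟨B, hB, rfl⟩ -
      exact (setIntegral_posteriorAverage_interp P t p₀ hσ hF hB hi.integrableOn).2
    · exact ((stronglyMeasurable_marginalVelocity P t p₀).comp_measurable
        (comap_measurable _)).aestronglyMeasurable
  have h2 : (fun ω : Eu d × Eu d => condVelocity P t (P.interp t ω) ω.1) =
      P.dα t • Prod.fst + P.dσ t • Prod.snd := by
    ext1 ω
    exact condVelocity_interp hσ ω
  rw [h2] at h1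
  filter_upwards [h1, condExp_add (hfst.smul (P.dα t)) (hsnd.smul (P.dσ t))
      (MeasurableSpace.comap (P.interp t) inferInstance),
    condExp_smul (μ := μ) (P.dα t) (Prod.fst : Eu d × Eu d → Eu d)
      (MeasurableSpace.comap (P.interp t) inferInstance),
    condExp_smul (μ := μ) (P.dσ t) (Prod.snd : Eu d × Eu d → Eu d)
      (MeasurableSpace.comap (P.interp t) inferInstance)] with ω h1 h2 h3 h4
  rw [h1, h2, Pi.add_apply, h3, h4, Pi.smul_apply, Pi.smul_apply]

/-- `Var_x` is the posterior average of the squared deviation, which is bounded by `(M₁ + M₂)²` over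
`A`, so disintegration applies. -/
lemma setIntegral_condVelocityVar_interp (hσ : 0 < P.σ t) {M₁ M₂ : ℝ} {A : Set (Eu d)}
    (hA : MeasurableSet A) (hM : ∀ᵐ x₀ ∂p₀, ∀ x ∈ A, ‖condVelocity P t x x₀‖ ≤ M₁)
    (hM₂ : ∀ x ∈ A, ‖marginalVelocity P t p₀ x‖ ≤ M₂) :
    IntegrableOn (fun ω => condVelocityVar P t p₀ (P.interp t ω)) (P.interp t ⁻¹' A)
      (p₀.prod (stdGaussian (Eu d))) ∧
    ∫ ω in P.interp t ⁻¹' A, condVelocityVar P t p₀ (P.interp t ω)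
        ∂(p₀.prod (stdGaussian (Eu d))) =
      ∫ ω in P.interp t ⁻¹' A, ‖condVelocity P t (P.interp t ω) ω.1 -
        marginalVelocity P t p₀ (P.interp t ω)‖ ^ 2 ∂(p₀.prod (stdGaussian (Eu d))) := by
  have hF : StronglyMeasurable fun z : Eu d × Eu d =>
      ‖condVelocity P t z.2 z.1 - marginalVelocity P t p₀ z.2‖ ^ 2 :=
    (((continuous_condVelocity P t).stronglyMeasurable.sub
      ((stronglyMeasurable_marginalVelocity P t p₀).comp_measurable measurable_snd)).norm.pow 2)
  refine setIntegral_posteriorAverage_interp P t p₀ hσ hF hA ?_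
  have hT : Measurable fun ω : Eu d × Eu d => (ω.1, P.interp t ω) :=
    measurable_fst.prodMk (measurable_interp P t)
  refine Integrable.of_bound (C := (M₁ + M₂) ^ 2)
    (hF.comp_measurable hT).aestronglyMeasurable ?_
  rw [ae_restrict_iff' (measurable_interp P t hA)]
  filter_upwards [Measure.quasiMeasurePreserving_fst.ae hM] with ω hω hωA
  rw [norm_pow, norm_norm]
  exact pow_le_pow_left₀ (norm_nonneg _)
    ((norm_sub_le _ _).trans (add_le_add (hω _ hωA) (hM₂ _ hωA))) 2

lemma setIntegral_norm_idealVelocity_sub_sq_le (hσ : 0 < P.σ t) {N : ℕ} (hN : 0 < N)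
    {z₀ M₁ M₂ : ℝ} (hz₀ : 0 < z₀) {A : Set (Eu d)} (hA : MeasurableSet A)
    (hM : ∀ᵐ x₀ ∂p₀, ∀ x ∈ A, ‖condVelocity P t x x₀‖ ≤ M₁)
    (hM₂ : ∀ x ∈ A, ‖marginalVelocity P t p₀ x‖ ≤ M₂)
    (hz : ∀ x ∈ A, ∀ᵐ y ∂(Measure.pi fun _ : Fin N => p₀),
      z₀ ≤ normConst P t (empiricalMeasure y) x) :
    IntegrableOn (fun w : (Eu d × Eu d) × (Fin N → Eu d) =>
        ‖idealVelocity P t w.2 (P.interp t w.1) - marginalVelocity P t p₀ (P.interp t w.1)‖ ^ 2)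
      {w | P.interp t w.1 ∈ A}
      ((p₀.prod (stdGaussian (Eu d))).prod (Measure.pi fun _ : Fin N => p₀)) ∧
    ∫ w in {w : (Eu d × Eu d) × (Fin N → Eu d) | P.interp t w.1 ∈ A},
        ‖idealVelocity P t w.2 (P.interp t w.1) - marginalVelocity P t p₀ (P.interp t w.1)‖ ^ 2
        ∂((p₀.prod (stdGaussian (Eu d))).prod (Measure.pi fun _ : Fin N => p₀)) ≤
      ((Real.sqrt (2 * Real.pi * P.σ t ^ 2) ^ d)⁻¹ / z₀) ^ 2 *
        ((∫ ω in P.interp t ⁻¹' A, ‖condVelocity P t (P.interp t ω) ω.1 -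
          marginalVelocity P t p₀ (P.interp t ω)‖ ^ 2 ∂(p₀.prod (stdGaussian (Eu d)))) / N) := by
  set ν := Measure.pi fun _ : Fin N => p₀ with hν
  set C := ((Real.sqrt (2 * Real.pi * P.σ t ^ 2) ^ d)⁻¹ / z₀) ^ 2
  set μ := (p₀.prod (stdGaussian (Eu d))).restrict (P.interp t ⁻¹' A) with hμ
  have hS : MeasurableSet (P.interp t ⁻¹' A) := measurable_interp P t hA
  have hres : ((p₀.prod (stdGaussian (Eu d))).prod ν).restrict
      {w : (Eu d × Eu d) × (Fin N → Eu d) | P.interp t w.1 ∈ A} = μ.prod ν := by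
    have hset : {w : (Eu d × Eu d) × (Fin N → Eu d) | P.interp t w.1 ∈ A} =
        (P.interp t ⁻¹' A) ×ˢ univ := by
      ext w
      simp
    rw [hset, ← Measure.prod_restrict, Measure.restrict_univ]
  obtain ⟨hVi, hVe⟩ := setIntegral_condVelocityVar_interp hσ hA hM hM₂
  have hae : ∀ x ∈ A, ∀ᵐ x₀ ∂p₀, ‖condVelocity P t x x₀‖ ≤ M₁ :=
    fun x hx => hM.mono fun x₀ h => h x hx
  have hint : Measurable fun w : (Eu d × Eu d) × (Fin N → Eu d) => P.interp t w.1 :=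
    (measurable_interp P t).comp measurable_fst
  have hm : StronglyMeasurable fun w : (Eu d × Eu d) × (Fin N → Eu d) =>
      ‖idealVelocity P t w.2 (P.interp t w.1) - marginalVelocity P t p₀ (P.interp t w.1)‖ ^ 2 :=
    ((measurable_idealVelocity P t hN hint measurable_snd).stronglyMeasurable.sub
      ((stronglyMeasurable_marginalVelocity P t p₀).comp_measurable hint)).norm.pow 2
  have hem : StronglyMeasurable fun ω => ∫ y, ‖idealVelocity P t y (P.interp t ω) -
      marginalVelocity P t p₀ (P.interp t ω)‖ ^ 2 ∂ν := hm.integral_prod_right'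
  have hle : ∀ᵐ ω ∂μ, ∫ y, ‖idealVelocity P t y (P.interp t ω) -
      marginalVelocity P t p₀ (P.interp t ω)‖ ^ 2 ∂ν ≤
        C * (condVelocityVar P t p₀ (P.interp t ω) / N) := by
    rw [hμ, ae_restrict_iff' hS]
    refine .of_forall fun ω hω => ?_
    exact integral_norm_idealVelocity_sub_sq_le (x := P.interp t ω) hσ hN hz₀
      (hae _ hω) (hz _ hω)
  have hVC : Integrable (fun ω => C * (condVelocityVar P t p₀ (P.interp t ω) / N)) μ :=
    (hVi.div_const _).const_mul _
  -- Domination by the pointwise bound; with integrability in `y`, this yields joint integrability.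
  have hei : Integrable (fun ω => ∫ y, ‖idealVelocity P t y (P.interp t ω) -
      marginalVelocity P t p₀ (P.interp t ω)‖ ^ 2 ∂ν) μ := by
    refine hVC.mono' hem.aestronglyMeasurable (hle.mono fun ω h => ?_)
    rwa [Real.norm_of_nonneg (integral_nonneg fun y => sq_nonneg _)]
  have hi : Integrable (fun w : (Eu d × Eu d) × (Fin N → Eu d) =>
      ‖idealVelocity P t w.2 (P.interp t w.1) - marginalVelocity P t p₀ (P.interp t w.1)‖ ^ 2)
      (μ.prod ν) := by
    rw [integrable_prod_iff hm.aestronglyMeasurable]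
    constructor
    · rw [hμ, ae_restrict_iff' hS]
      refine .of_forall fun ω hω => ?_
      exact integrable_norm_idealVelocity_sub_sq (x := P.interp t ω) hσ hN (hae _ hω)
        (marginalVelocity P t p₀ (P.interp t ω))
    · simpa only [norm_pow, norm_norm] using hei
  rw [IntegrableOn, hres]
  refine ⟨hi, ?_⟩
  rw [integral_prod _ hi, ← hVe]
  refine (integral_mono_ae hei hVC hle).trans_eq ?_
  rw [integral_const_mul, integral_div]

end averaged

/-! ### The main theorem -/

theorem proposition3 (d : ℕ) (P : FlowPath) (t : ℝ) (ht : t ∈ Icc (0 : ℝ) 1) (hσ : 0 < P.σ t)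
    (hα' : DifferentiableWithinAt ℝ P.α (Icc 0 1) t)
    (hσ' : DifferentiableWithinAt ℝ P.σ (Icc 0 1) t) :
    -- the marginal velocity is `α̇_t E[x_0 | x_t] + σ̇_t E[ε | x_t]`, for every data distribution
    (∀ (p₀ : Measure (Eu d)) [IsProbabilityMeasure p₀], Integrable id p₀ →
      (fun ω => marginalVelocity P t p₀ (P.interp t ω))
        =ᵐ[p₀.prod (stdGaussian (Eu d))]
      (fun ω =>
        P.dα t • (p₀.prod (stdGaussian (Eu d)))[Prod.fst |
            MeasurableSpace.comap (P.interp t) inferInstance] ω +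
        P.dσ t • (p₀.prod (stdGaussian (Eu d)))[Prod.snd |
            MeasurableSpace.comap (P.interp t) inferInstance] ω)) ∧
    -- the marginal velocity of an empirical data distribution
    (∀ (N : ℕ), 0 < N → ∀ (y : Fin N → Eu d) (x : Eu d),
      marginalVelocity P t (empiricalMeasure y) x =
        ∑ i, (gaussianDensity x (P.α t • y i) (P.σ t) /
            ∑ j, gaussianDensity x (P.α t • y j) (P.σ t)) •
          (P.dα t • y i + (P.dσ t / P.σ t) • (x - P.α t • y i))) ∧
    -- bias, variance and mean-square error of the plug-in velocity for `N` i.i.d. data points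
    (∀ (s : ℝ), (d : ℝ) / 2 < s → ∀ (z₀ : ℝ), 0 < z₀ →
      ∃ C : ℝ, 0 < C ∧
        ∀ (p₀ : Measure (Eu d)) [IsProbabilityMeasure p₀] (N : ℕ) (M₁ M₂ : ℝ)
          (Ω A : Set (Eu d)),
          0 < N → 0 < M₁ → 0 < M₂ → IsOpen Ω → p₀ Ωᶜ = 0 → MeasurableSet A →
          (∀ x ∈ A, z₀ ≤ normConst P t p₀ x) →
          (∀ x ∈ A, ∀ᵐ y ∂(Measure.pi fun _ : Fin N => p₀),
            z₀ ≤ normConst P t (empiricalMeasure y) x) →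
          (∀ x ∈ A, CsNormLE s Ω (condVelocity P t x) M₁) →
          (∀ x ∈ A, ‖marginalVelocity P t p₀ x‖ ≤ M₂) →
          -- at every point `x_t = x` of the region `A`
          (∀ x ∈ A,
            MemLp (fun y => idealVelocity P t y x) 2 (Measure.pi fun _ : Fin N => p₀) ∧
            ∫ y, ‖idealVelocity P t y x - marginalVelocity P t p₀ x‖ ^ 2
                ∂(Measure.pi fun _ : Fin N => p₀) ≤
              C * ((M₁ ^ 2 + 2 * M₂ ^ 2) / N + 4 * condVelocityVar P t p₀ x / N) ∧
            ‖(∫ y, idealVelocity P t y x ∂(Measure.pi fun _ : Fin N => p₀)) -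
                marginalVelocity P t p₀ x‖ ^ 2 ≤ C * (M₁ ^ 2 / N) ∧
            (1 - C / N) * condVelocityVar P t p₀ x ≤
              condVelocityVar P t p₀ x -
                ∫ y, ‖idealVelocity P t y x -
                    ∫ y', idealVelocity P t y' x ∂(Measure.pi fun _ : Fin N => p₀)‖ ^ 2
                  ∂(Measure.pi fun _ : Fin N => p₀)) ∧
          -- on average over `x_t = α_t x_0 + σ_t ε` in the region `A`
          (IntegrableOn
              (fun w : (Eu d × Eu d) × (Fin N → Eu d) =>
                ‖idealVelocity P t w.2 (P.interp t w.1) -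
                  marginalVelocity P t p₀ (P.interp t w.1)‖ ^ 2)
              {w | P.interp t w.1 ∈ A}
              ((p₀.prod (stdGaussian (Eu d))).prod (Measure.pi fun _ : Fin N => p₀)) ∧
            ∫ w in {w : (Eu d × Eu d) × (Fin N → Eu d) | P.interp t w.1 ∈ A},
                ‖idealVelocity P t w.2 (P.interp t w.1) -
                  marginalVelocity P t p₀ (P.interp t w.1)‖ ^ 2
                ∂((p₀.prod (stdGaussian (Eu d))).prod (Measure.pi fun _ : Fin N => p₀)) ≤
              C * ((M₁ ^ 2 + 2 * M₂ ^ 2) / N +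
                4 * (∫ ω in {ω : Eu d × Eu d | P.interp t ω ∈ A},
                  ‖condVelocity P t (P.interp t ω) ω.1 -
                    marginalVelocity P t p₀ (P.interp t ω)‖ ^ 2
                  ∂(p₀.prod (stdGaussian (Eu d)))) / N))) := by
  -- The constant is `C = (K / z₀)²`, with `K = (2πσ_t²)^(-d/2)` the peak of the transition density.
  refine ⟨fun p₀ _ hp => marginalVelocity_interp_ae_eq hσ hp,
    fun N hN y x => idealVelocity_eq_sum P t hN y x, fun s _ z₀ hz₀ =>
    ⟨((Real.sqrt (2 * Real.pi * P.σ t ^ 2) ^ d)⁻¹ / z₀) ^ 2, by positivity, ?_⟩⟩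
  intro p₀ _ N M₁ M₂ Ω A hN _ _ _ hΩ hA _ hz hCs hM₂
  set C := ((Real.sqrt (2 * Real.pi * P.σ t ^ 2) ^ d)⁻¹ / z₀) ^ 2
  have hC : 0 ≤ C := sq_nonneg _
  -- The order-zero part of the `C^s` bound holds on `Ω`, a set of full measure that serves all `x ∈
  -- A` at once.
  have hM : ∀ᵐ x₀ ∂p₀, ∀ x ∈ A, ‖condVelocity P t x x₀‖ ≤ M₁ := by
    filter_upwards [mem_ae_iff.2 hΩ] with x₀ hx₀ x hx
    simpa using (hCs x hx).2.1 0 (Nat.zero_le _) x₀ hx₀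
  have hweaken : ∀ V : ℝ, 0 ≤ V →
      C * (V / N) ≤ C * ((M₁ ^ 2 + 2 * M₂ ^ 2) / N + 4 * V / N) := by
    intro V hV
    rw [← add_div]
    gcongr
    nlinarith [sq_nonneg M₁, sq_nonneg M₂]
  refine ⟨fun x hx => ?_, ?_⟩
  · have hMx : ∀ᵐ x₀ ∂p₀, ‖condVelocity P t x x₀‖ ≤ M₁ := hM.mono fun x₀ h => h x hx
    have hL := memLp_idealVelocity (N := N) hσ hN hMx
    have hmse := integral_norm_idealVelocity_sub_sq_le hσ hN hz₀ hMx (hz x hx)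
    have hV := condVelocityVar_nonneg (p₀ := p₀) (x := x) hσ
    have hdec := integral_norm_sub_sq _ hL (marginalVelocity P t p₀ x)
    refine ⟨hL, hmse.trans (hweaken _ hV), ?_, ?_⟩
    · calc _ ≤ C * (condVelocityVar P t p₀ x / N) := by
            refine le_trans ?_ hmse
            rw [hdec]
            exact le_add_of_nonneg_left (integral_nonneg fun y => sq_nonneg _)
        _ ≤ C * (M₁ ^ 2 / N) := by
            gcongr
            exact condVelocityVar_le hσ hMx
    -- The variance of `v*` is the mean square error minus the squared bias, hence at most `C Var_x
    -- / N`.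
    · have hle := hmse
      rw [hdec] at hle
      have h2 := sq_nonneg
        ‖(∫ y, idealVelocity P t y x ∂(Measure.pi fun _ : Fin N => p₀)) - marginalVelocity P t p₀ x‖
      have h3 : C / N * condVelocityVar P t p₀ x = C * (condVelocityVar P t p₀ x / N) := by ring
      rw [sub_mul, one_mul, h3]
      linarith
  · obtain ⟨hi, hle⟩ := setIntegral_norm_idealVelocity_sub_sq_le hσ hN hz₀ hA hM hM₂ hz
    exact ⟨hi, hle.trans (hweaken _ (integral_nonneg fun ω => sq_nonneg _))⟩
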